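/- A represented space is a set $X$ with a partial surjection $\delta_X :\subseteq \mathbb{N}^{\mathbb{N}} \to X$ (if $\delta_X(p)=x$, then $p$ is a name of $x$). A problem is a partial multivalued function $f :\subseteq X \rightrightarrows Y$ between represented spaces; a realizer of $f$ is a partial function on $\mathbb{N}^{\mathbb{N}}$ that maps every name of every $x \in \operatorname{dom}(f)$ to a name of some $y \in f(x)$. For problems $f, g$ write $f \leq_{\mathrm{W}} g$ (Weihrauch reducibility) if there are computable $H, K :\subseteq \mathbb{N}^{\mathbb{N}} \to \mathbb{N}^{\mathbb{N}}$ such that $p \mapsto H\langle p, G(K(p))\rangle$ is a realizer of $f$ for every realizer $G$ of $g$. The problem $f^k$ is the $k$-fold parallel product $f \times \dots \times f$. The jump $f'$ is the same multivalued function as $f$, where an instance $x$ is given by a sequence in $\mathbb{N}^{\mathbb{N}}$ that converges to a name of $x$. Let $\mathrm{TC}_{\mathbb{N}}$ be the problem which takes as input an enumeration of the complement of a set $A \subseteq \mathbb{N}$ and returns some $n \in A$ if $A \neq \emptyset$, and an arbitrary $n \in \mathbb{N}$ if $A = \emptyset$. Let $\mathrm{RT}^1_k$ be the problem which takes as input a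 colouring $c : \mathbb{N} \to \{0,\dots,k-1\}$ and returns (the characteristic function of) an infinite set $S \subseteq \mathbb{N}$ on which $c$ is constant. Then, for every $k \in \mathbb{N}$, $$\mathrm{TC}_{\mathbb{N}}^k \leq_{\mathrm{W}} (\mathrm{RT}^1_{k+1})'.$$ -/

import Mathlib

namespace Weihrauch

open Filter Topology

/-- Baire space `ℕ^ℕ`. -/
abbrev Baire : Type := ℕ → ℕ

/-! ### Computable partial functions on Baire space -/

/-- The finite prefix `p(0), …, p(n-1)` of `p`. -/
def pre (p : Baire) (n : ℕ) : List ℕ := (List.range n).map p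

/-- The word function `φ`, run on longer and longer prefixes of `p`, outputs longer and longer
prefixes of `q`, and thus outputs all of `q`. -/
def Produces (φ : List ℕ → List ℕ) (p q : Baire) : Prop :=
  (∀ n, φ (pre p n) = pre q (φ (pre p n)).length) ∧
  (∀ m, ∃ n, m ≤ (φ (pre p n)).length)

/-- Type-2 computability of a partial function `F :⊆ ℕ^ℕ → ℕ^ℕ`: there is a computable function on
finite words, monotone for the prefix order, that produces `F(p)` from `p` for all `p ∈ dom F`. -/
def ComputableOnBaire (F : Baire →. Baire) : Prop :=
  ∃ φ : List ℕ → List ℕ, Computable φ ∧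
    (∀ s t : List ℕ, s <+: t → φ s <+: φ t) ∧
    ∀ p q, q ∈ F p → Produces φ p q

/-- The pairing `⟨p, q⟩` of Baire space: `⟨p, q⟩(2n) = p(n)` and `⟨p, q⟩(2n+1) = q(n)`. -/
def interleave (p q : Baire) : Baire := fun n => if n % 2 = 0 then p (n / 2) else q (n / 2)

/-- The `i`-th component of `p`, read as a `k`-tuple `⟨p₀, …, p_{k-1}⟩` of points of Baire space:
`p(k n + i) = pᵢ(n)`. -/
def component (k i : ℕ) (p : Baire) : Baire := fun n => p (k * n + i)

/-- The `i`-th entry of `p`, read as a sequence `⟨p₀, p₁, p₂, …⟩` of points of Baire space. -/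
def entry (i : ℕ) (p : Baire) : Baire := fun n => p (Nat.pair i n)

/-! ### Represented spaces and multivalued functions -/

/-- A represented space: a set with a partial surjection from Baire space onto it.
The partial surjection is given by its graph: `names p x` says that `p` is a name of `x`. -/
structure RepSpace where
  /-- the underlying set -/
  carrier : Type
  /-- the graph of the representation -/
  names : Baire → carrier → Prop
  names_unique : ∀ p x y, names p x → names p y → x = y
  names_surj : ∀ x, ∃ p, names p x

/-- A problem, that is, a partial multivalued function `f :⊆ X ⇉ Y` between represented spaces;
its domain is the set of all `x` with `f(x) ≠ ∅`. -/
structure Problem where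
  /-- the space of instances -/
  inp : RepSpace
  /-- the space of solutions -/
  out : RepSpace
  /-- the set of solutions of an instance -/
  sol : inp.carrier → Set out.carrier

/-- `F` is a realizer of `f`: it maps each name of each `x ∈ dom f` to a name of some `y ∈ f(x)`. -/
def Realizes (F : Baire →. Baire) (f : Problem) : Prop :=
  ∀ p x, f.inp.names p x → (f.sol x).Nonempty →
    ∃ q ∈ F p, ∃ y ∈ f.sol x, f.out.names q y

/-- Weihrauch reducibility `f ≤_W g`: there are computable `H, K :⊆ ℕ^ℕ → ℕ^ℕ` such that
`p ↦ H⟨p, G(K(p))⟩` is a realizer of `f` for every realizer `G` of `g`. -/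
def Reducible (f g : Problem) : Prop :=
  ∃ H K : Baire →. Baire, ComputableOnBaire H ∧ ComputableOnBaire K ∧
    ∀ G : Baire →. Baire, Realizes G g →
      Realizes (fun p => (K p).bind fun q => (G q).bind fun r => H (interleave p r)) f

/-! ### Operations on problems -/

theorem interleave_component_exists (k : ℕ) (q : Fin k → Baire) :
    ∃ p : Baire, ∀ i : Fin k, component k i p = q i := by
  refine ⟨fun m => if h : m % k < k then q ⟨m % k, h⟩ (m / k) else 0, fun i => ?_⟩
  funext n
  have hk : 0 < k := i.pos
  have h1 : (k * n + i) % k = i := by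
    rw [Nat.mul_add_mod]; exact Nat.mod_eq_of_lt i.2
  have h2 : (k * n + i) / k = n := by
    rw [Nat.mul_add_div hk, Nat.div_eq_of_lt i.2, add_zero]
  simp [component, h1, h2]

/-- The power `X^k` of a represented space; names are `k`-tuples of names. -/
def RepSpace.pow (X : RepSpace) (k : ℕ) : RepSpace where
  carrier := Fin k → X.carrier
  names p x := ∀ i : Fin k, X.names (component k i p) (x i)
  names_unique p x y hx hy := funext fun i => X.names_unique _ _ _ (hx i) (hy i)
  names_surj x := by
    choose q hq using fun i => X.names_surj (x i)
    obtain ⟨p, hp⟩ := interleave_component_exists k q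
    exact ⟨p, fun i => by rw [hp i]; exact hq i⟩

/-- The `k`-fold product `f^k = f × ⋯ × f`: solve `k` instances of `f` in parallel. -/
def Problem.pow (f : Problem) (k : ℕ) : Problem where
  inp := f.inp.pow k
  out := f.out.pow k
  sol x := {y | ∀ i : Fin k, y i ∈ f.sol (x i)}

/-- The jump `X'` of a represented space: a name of `x` in `X'` is a sequence of points of Baire
space that converges to a name of `x` in `X`. -/
def RepSpace.jump (X : RepSpace) : RepSpace where
  carrier := X.carrier
  names p x := ∃ q : Baire, Tendsto (fun i => entry i p) atTop (𝓝 q) ∧ X.names q x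
  names_unique := by
    rintro p x y ⟨q, hq, hx⟩ ⟨r, hr, hy⟩
    obtain rfl := tendsto_nhds_unique hq hr
    exact X.names_unique _ _ _ hx hy
  names_surj x := by
    obtain ⟨q, hq⟩ := X.names_surj x
    refine ⟨fun m => q m.unpair.2, q, ?_, hq⟩
    have h : (fun i => entry i fun m => q m.unpair.2) = fun _ => q := by
      funext i n
      simp [entry]
    rw [h]
    exact tendsto_const_nhds

/-- The jump `f'` of a problem: the same multivalued function, with instances given in `X'`. -/
def Problem.jump (f : Problem) : Problem where
  inp := f.inp.jump
  out := f.out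
  sol := f.sol

/-! ### The represented spaces and problems of interest -/

/-- The natural numbers; `p` is a name of `p(0)`. -/
def natSpace : RepSpace where
  carrier := ℕ
  names p n := p 0 = n
  names_unique _ _ _ hx hy := hx.symm.trans hy
  names_surj n := ⟨fun _ => n, rfl⟩

/-- The sets of natural numbers given by an enumeration of the complement: `p` is a name of `A` if
the `n + 1` in the range of `p` are exactly those with `n ∉ A` (an entry `0` enumerates nothing). -/
def coEnumSpace : RepSpace where
  carrier := Set ℕ
  names p A := ∀ n, n ∉ A ↔ ∃ m, p m = n + 1
  names_unique p A B hA hB := by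
    ext n
    exact not_iff_not.mp ((hA n).trans (hB n).symm)
  names_surj A := by
    classical
    refine ⟨fun m => if m ∈ A then 0 else m + 1, fun n => ⟨fun h => ⟨n, by simp [h]⟩, ?_⟩⟩
    rintro ⟨m, hm⟩ hn
    by_cases h : m ∈ A
    · simp [h] at hm
    · simp only [h, if_false] at hm
      exact h (Nat.succ_injective hm ▸ hn)

/-- The sets of natural numbers given by their characteristic functions. -/
def charSpace : RepSpace where
  carrier := Set ℕ
  names p A := ∀ n, (n ∈ A ∧ p n = 1) ∨ (n ∉ A ∧ p n = 0)
  names_unique p A B hA hB := by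
    ext n
    rcases hA n with h | h <;> rcases hB n with h' | h' <;> simp_all
  names_surj A := by
    classical
    refine ⟨fun n => if n ∈ A then 1 else 0, fun n => ?_⟩
    by_cases h : n ∈ A <;> simp [h]

/-- The colourings `c : ℕ → {0, …, k-1}`; the name of `c` is `c` itself. -/
def colouringSpace (k : ℕ) : RepSpace where
  carrier := ℕ → Fin k
  names p c := ∀ n, p n = c n
  names_unique _ _ _ hc hd := funext fun n => Fin.ext ((hc n).symm.trans (hd n))
  names_surj c := ⟨fun n => c n, fun _ => rfl⟩

/-- `TC_ℕ`: given an enumeration of the complement of `A ⊆ ℕ`, return some `n ∈ A` if `A` is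
non-empty, and an arbitrary `n ∈ ℕ` otherwise. -/
def TCN : Problem where
  inp := coEnumSpace
  out := natSpace
  sol := fun A : Set ℕ => {n : ℕ | A.Nonempty → n ∈ A}

/-- `RT¹_k`: given `c : ℕ → {0, …, k-1}`, return an infinite set on which `c` is constant. -/
def RT1 (k : ℕ) : Problem where
  inp := colouringSpace k
  out := charSpace
  sol := fun c : ℕ → Fin k => {S : Set ℕ | S.Infinite ∧ ∃ i, ∀ n ∈ S, c n = i}

end Weihrauch

namespace Weihrauch

open Filter Topology

/-! ### Words and prefixes -/

/-! At stage `n`, guess for each of the `k` sets the least number not yet enumerated into its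
complement. A correct guess never changes again (`candidate_eq_of_le`), and for a nonempty set the
guess is eventually correct (`exists_candidate_mem`). So the number of correct guesses is
nondecreasing in `n` and takes values in `{0, …, k}`. It serves as a colouring with `k + 1` colours,
computable in the limit because every wrong guess is eventually refuted
(`jump_names_correctColouring`). A stage in an infinite homogeneous set has as many correct guesses
as arbitrarily late stages, so it is already correct wherever correctness is possible
(`candidate_mem_of_homogeneous`). One element of the solution therefore suffices to read off all `k`
answers. -/

@[simp] theorem length_pre (p : Baire) (n : ℕ) : (pre p n).length = n := by
  simp [pre]

theorem getD_pre (p : Baire) {n i : ℕ} (h : i < n) : (pre p n).getD i 0 = p i := by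
  simp [pre, List.getD, h]

theorem take_pre (p : Baire) {m n : ℕ} (h : m ≤ n) : (pre p n).take m = pre p m := by
  rw [pre, ← List.map_take, List.take_range, min_eq_left h, pre]

theorem pre_prefix (p : Baire) {m n : ℕ} (h : m ≤ n) : pre p m <+: pre p n :=
  take_pre p h ▸ List.take_prefix m _

theorem pre_getD (w : List ℕ) : pre (fun i => w.getD i 0) w.length = w := by
  apply List.ext_getElem
  · simp
  · intro i h₁ h₂
    simp [pre, h₂]

theorem pre_congr {p q : Baire} {n : ℕ} (h : ∀ i < n, p i = q i) : pre p n = pre q n :=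
  List.map_congr_left fun i hi => h i (List.mem_range.mp hi)

/-- Monotonicity of a word function needs to be checked on prefixes of points of Baire space
only. -/
theorem prefix_monotone_of_pre {φ : List ℕ → List ℕ}
    (h : ∀ (p : Baire) (m n : ℕ), m ≤ n → φ (pre p m) <+: φ (pre p n)) (s t : List ℕ)
    (hst : s <+: t) : φ s <+: φ t := by
  -- Padding `t` with zeros gives a point of which both words are prefixes.
  have key := h (fun i => t.getD i 0) s.length t.length hst.length_le
  rwa [← take_pre _ hst.length_le, pre_getD, ← List.prefix_iff_eq_take.mp hst] at key

theorem findIdx_range_eq {n y : ℕ} {P : ℕ → Bool} (hy : y ≤ n) (h : ∀ x < y, P x = false)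
    (h' : y = n ∨ P y = true) : (List.range n).findIdx P = y := by
  rcases hy.lt_or_eq with hlt | rfl
  · rw [List.findIdx_eq (by simpa using hlt)]
    refine ⟨?_, fun j hj => by simpa using h j hj⟩
    simpa using h'.resolve_left hlt.ne
  · rw [List.findIdx_eq_length_of_false (fun x hx => h x (List.mem_range.mp hx)),
      List.length_range]

theorem eq_false_of_lt_findIdx_range {n x : ℕ} {P : ℕ → Bool}
    (h : x < (List.range n).findIdx P) : P x = false := by
  simpa using List.not_of_lt_findIdx h

/-- A total function whose `m`-th output is computed from the first `m` inputs is computable. -/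
theorem computableOnBaire_of_pre {g : List ℕ → ℕ} (hg : Primrec g) :
    ComputableOnBaire fun p => Part.some fun m => g (pre p m) := by
  have hφ : ∀ (p : Baire) (n : ℕ), (List.range (pre p n).length).map
      (fun m => g ((pre p n).take m)) = pre (fun m => g (pre p m)) n := by
    intro p n
    rw [length_pre]
    exact List.map_congr_left fun m hm => by rw [take_pre p (List.mem_range.mp hm).le]
  refine ⟨fun s => (List.range s.length).map fun m => g (s.take m), ?_, ?_, ?_⟩
  · exact (Primrec.list_map (Primrec.list_range.comp Primrec.list_length)
      (hg.comp (Primrec.list_take.comp Primrec.snd Primrec.fst)).to₂).to_comp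
  · exact prefix_monotone_of_pre fun p m n hmn => by
      simp only [hφ]
      exact pre_prefix _ hmn
  · intro p q hq
    obtain rfl := Part.mem_some_iff.mp hq
    exact ⟨fun n => by simp only [hφ]; rw [length_pre], fun m => ⟨m, by simp⟩⟩

/-! ### Candidates for elements of the complements of enumerated sets -/

/-- Within the word `u`, the `j`-th component of a `k`-tuple enumerates `x`. -/
def enumerated (k : ℕ) (u : List ℕ) (j x : ℕ) : Bool :=
  decide (∃ i < u.length, i % k = j ∧ u.getD i 0 = x + 1)

/-- The least number that the `j`-th component of a `k`-tuple has not enumerated within `u`. -/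
def candidate (k : ℕ) (u : List ℕ) (j : ℕ) : ℕ :=
  -- A word enumerates at most `u.length` numbers, so one of these `u.length + 1` is free.
  (List.range (u.length + 1)).findIdx fun x => !enumerated k u j x

/-- The indices `j < k` for which the candidate computed from `u` is not enumerated within `v`. -/
def surviving (k : ℕ) (u v : List ℕ) : List ℕ :=
  (List.range k).filter fun j => !enumerated k v j (candidate k u j)

/-- The `⟨i, n⟩`-th value counts the candidates of stage `n` that survive until stage `i`. -/
def approxColour (k : ℕ) (v : List ℕ) : ℕ :=
  -- The length of `v` encodes the position `⟨i, n⟩`; it bounds `i` and `n`, so `v` contains both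
  -- prefixes.
  (surviving k (v.take v.length.unpair.2) (v.take v.length.unpair.1)).length

/-! ### Primitive recursiveness of the approximation. -/

theorem primrec_enumerated (k : ℕ) :
    Primrec fun a : List ℕ × ℕ × ℕ => enumerated k a.1 a.2.1 a.2.2 := by
  have hR : PrimrecRel fun (i : ℕ) (a : List ℕ × ℕ × ℕ) =>
      i % k = a.2.1 ∧ a.1.getD i 0 = a.2.2 + 1 := by
    refine PrimrecPred.and ?_ ?_
    · exact Primrec.eq.comp (Primrec.nat_mod.comp Primrec.fst (Primrec.const k))
        (Primrec.fst.comp (Primrec.snd.comp Primrec.snd))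
    · exact Primrec.eq.comp
        ((Primrec.list_getD 0).comp (Primrec.fst.comp Primrec.snd) Primrec.fst)
        (Primrec.succ.comp (Primrec.snd.comp (Primrec.snd.comp Primrec.snd)))
  have hE : PrimrecPred fun a : List ℕ × ℕ × ℕ =>
      ∃ i < a.1.length, i % k = a.2.1 ∧ a.1.getD i 0 = a.2.2 + 1 :=
    (hR.exists_mem_list.comp (Primrec.list_range.comp (Primrec.list_length.comp Primrec.fst))
      Primrec.id).of_eq (by simp)
  exact hE.decide

theorem primrec_candidate (k : ℕ) : Primrec₂ (candidate k) := by
  refine Primrec.list_findIdx (Primrec.list_range.comp (Primrec.succ.comp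
    (Primrec.list_length.comp Primrec.fst))) ?_
  exact (Primrec.not.comp ((primrec_enumerated k).comp (Primrec.pair
    (Primrec.fst.comp Primrec.fst) (Primrec.pair (Primrec.snd.comp Primrec.fst)
      Primrec.snd)))).to₂

theorem primrec_surviving (k : ℕ) : Primrec₂ (surviving k) := by
  have hR : PrimrecRel fun (j : ℕ) (a : List ℕ × List ℕ) =>
      (!enumerated k a.2 j (candidate k a.1 j)) = true := by
    refine Primrec.eq.comp (Primrec.not.comp ((primrec_enumerated k).comp (Primrec.pair
      (Primrec.snd.comp Primrec.snd) (Primrec.pair Primrec.fst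
        ((primrec_candidate k).comp (Primrec.fst.comp Primrec.snd) Primrec.fst)))))
      (Primrec.const true)
  refine (hR.listFilter.comp (Primrec.const (List.range k)) Primrec.id).of_eq fun a => ?_
  simp [surviving]

theorem primrec_approxColour (k : ℕ) : Primrec (approxColour k) :=
  Primrec.list_length.comp ((primrec_surviving k).comp
    (Primrec.list_take.comp (Primrec.snd.comp (Primrec.unpair.comp Primrec.list_length)) Primrec.id)
    (Primrec.list_take.comp (Primrec.fst.comp (Primrec.unpair.comp Primrec.list_length))
      Primrec.id))

theorem enumerated_pre {k n j x : ℕ} {p : Baire} :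
    enumerated k (pre p n) j x = true ↔ ∃ i < n, i % k = j ∧ p i = x + 1 := by
  simp only [enumerated, decide_eq_true_eq, length_pre]
  refine exists_congr fun i => and_congr_right fun hi => ?_
  rw [getD_pre p hi]

theorem enumerated_mono {k m n j x : ℕ} {p : Baire} (hmn : m ≤ n)
    (h : enumerated k (pre p m) j x = true) : enumerated k (pre p n) j x = true := by
  obtain ⟨i, hi, h⟩ := enumerated_pre.mp h
  exact enumerated_pre.mpr ⟨i, hi.trans_le hmn, h⟩

theorem enumerated_of_lt_candidate {k j x : ℕ} {u : List ℕ} (h : x < candidate k u j) :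
    enumerated k u j x = true := by
  simpa using eq_false_of_lt_findIdx_range h

/-! ### Correct candidates and the colouring that counts them. -/

section Instance

variable {k : ℕ} {p : Baire} {A : Fin k → Set ℕ}

theorem notMem_iff_exists_enumerated (hA : (TCN.pow k).inp.names p A) (j : Fin k) (x : ℕ) :
    x ∉ A j ↔ ∃ n, enumerated k (pre p n) j x = true := by
  have h : x ∉ A j ↔ ∃ m, p (k * m + j) = x + 1 := hA j x
  rw [h]
  constructor
  · rintro ⟨m, hm⟩
    refine ⟨k * m + j + 1, enumerated_pre.mpr ⟨k * m + j, Nat.lt_succ_self _, ?_, hm⟩⟩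
    rw [Nat.mul_add_mod, Nat.mod_eq_of_lt j.2]
  · rintro ⟨n, hn⟩
    obtain ⟨i, -, hij, hi⟩ := enumerated_pre.mp hn
    exact ⟨i / k, by rw [← hij, Nat.div_add_mod, hi]⟩

theorem not_enumerated_of_mem (hA : (TCN.pow k).inp.names p A) {j : Fin k} {x : ℕ}
    (hx : x ∈ A j) (n : ℕ) : enumerated k (pre p n) j x = false := by
  by_contra h
  exact (notMem_iff_exists_enumerated hA j x).mpr ⟨n, by simpa using h⟩ hx

/-- All smaller numbers stay enumerated, while an element of `A j` never becomes so. -/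
theorem candidate_eq_of_le (hA : (TCN.pow k).inp.names p A) {j : Fin k} {m n : ℕ}
    (hmn : m ≤ n) (h : candidate k (pre p m) j ∈ A j) :
    candidate k (pre p n) j = candidate k (pre p m) j := by
  refine findIdx_range_eq ?_ (fun x hx => ?_) (Or.inr ?_)
  · refine List.findIdx_le_length.trans ?_
    simpa using hmn
  · simpa using enumerated_mono hmn (enumerated_of_lt_candidate hx)
  · simpa using not_enumerated_of_mem hA h n

theorem exists_candidate_mem (hA : (TCN.pow k).inp.names p A) {j : Fin k}
    (h : (A j).Nonempty) : ∃ n, candidate k (pre p n) j ∈ A j := by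
  classical
  have hmin : ∀ x < Nat.find h, ∀ᶠ n in atTop, enumerated k (pre p n) j x = true := by
    intro x hx
    obtain ⟨m, hm⟩ := (notMem_iff_exists_enumerated hA j x).mp (Nat.find_min h hx)
    exact eventually_atTop.mpr ⟨m, fun n hn => enumerated_mono hn hm⟩
  have hall := (Set.finite_lt_nat (Nat.find h)).eventually_all.mpr hmin
  -- The bound `hle` puts the least element of `A j` inside the search range.
  obtain ⟨n, hn, hle⟩ := (hall.and (eventually_ge_atTop (Nat.find h))).exists
  refine ⟨n, ?_⟩
  have heq : candidate k (pre p n) j = Nat.find h := by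
    refine findIdx_range_eq ?_ (fun x hx => ?_) (Or.inr ?_)
    · simpa using hle.trans n.le_succ
    · simpa using hn x hx
    · simpa using not_enumerated_of_mem hA (Nat.find_spec h) n
  rw [heq]
  exact Nat.find_spec h

open Classical in
/-- The indices `j < k` for which the candidate of stage `n` is correct. -/
noncomputable def correct (A : Fin k → Set ℕ) (p : Baire) (n : ℕ) : List ℕ :=
  (List.range k).filter fun j => ∃ h : j < k, candidate k (pre p n) j ∈ A ⟨j, h⟩

theorem mem_correct {n : ℕ} {j : Fin k} :
    (j : ℕ) ∈ correct A p n ↔ candidate k (pre p n) j ∈ A j := by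
  simp [correct]

/-- Stated for sublists so that equal lengths force equal lists. -/
theorem correct_sublist (hA : (TCN.pow k).inp.names p A) {m n : ℕ} (hmn : m ≤ n) :
    (correct A p m).Sublist (correct A p n) := by
  refine List.monotone_filter_right _ fun j hj => ?_
  simp only [decide_eq_true_eq] at hj ⊢
  obtain ⟨h, hj⟩ := hj
  have heq := candidate_eq_of_le hA hmn hj
  exact ⟨h, by simpa only [heq] using hj⟩

theorem length_correct_lt (n : ℕ) : (correct A p n).length < k + 1 :=
  Nat.lt_succ_of_le ((List.length_filter_le _ _).trans_eq List.length_range)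

/-- With `n` fixed, correct candidates survive forever, and the finitely many wrong ones are each
enumerated at some stage. -/
theorem eventually_surviving_eq (hA : (TCN.pow k).inp.names p A) (n : ℕ) :
    ∀ᶠ i in atTop, surviving k (pre p n) (pre p i) = correct A p n := by
  classical
  have h : ∀ j ∈ Set.Iio k, ∀ᶠ i in atTop,
      (!enumerated k (pre p i) j (candidate k (pre p n) j)) =
        decide (∃ h : j < k, candidate k (pre p n) j ∈ A ⟨j, h⟩) := by
    intro j hj
    by_cases hc : candidate k (pre p n) j ∈ A ⟨j, hj⟩
    · refine Eventually.of_forall fun i => ?_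
      have := not_enumerated_of_mem hA hc i
      simp only at this
      simp [this, hc, Set.mem_Iio.mp hj]
    · obtain ⟨m, hm⟩ := (notMem_iff_exists_enumerated hA ⟨j, hj⟩ _).mp hc
      refine eventually_atTop.mpr ⟨m, fun i hi => ?_⟩
      have := enumerated_mono hi hm
      simp only at this
      simp [this, hc]
  filter_upwards [(Set.finite_Iio k).eventually_all.mpr h] with i hi
  rw [surviving, correct]
  exact List.filter_congr fun j hj => by
    rw [hi j (List.mem_range.mp hj)]

/-- The colouring that counts the correct candidates. -/
noncomputable def correctColouring (A : Fin k → Set ℕ) (p : Baire) (n : ℕ) : Fin (k + 1) :=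
  ⟨(correct A p n).length, length_correct_lt n⟩

theorem jump_names_correctColouring (hA : (TCN.pow k).inp.names p A) :
    (RT1 (k + 1)).jump.inp.names (fun m => approxColour k (pre p m)) (correctColouring A p) := by
  refine ⟨fun n => (correct A p n).length, ?_, fun n => rfl⟩
  refine tendsto_pi_nhds.mpr fun n => tendsto_nhds_of_eventually_eq ?_
  filter_upwards [eventually_surviving_eq hA n] with i hi
  rw [entry, approxColour, length_pre, Nat.unpair_pair, take_pre _ (Nat.right_le_pair i n),
    take_pre _ (Nat.left_le_pair i n), hi]

theorem candidate_mem_of_homogeneous (hA : (TCN.pow k).inp.names p A) {S : Set ℕ}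
    (hS : S.Infinite) {i : Fin (k + 1)} (hi : ∀ n ∈ S, correctColouring A p n = i) {s : ℕ}
    (hs : s ∈ S) {j : Fin k} (hj : (A j).Nonempty) : candidate k (pre p s) j ∈ A j := by
  obtain ⟨m, hm⟩ := exists_candidate_mem hA hj
  -- By stage `t` the `j`-th candidate is correct; equal colours carry this back to `s`.
  obtain ⟨t, ht, hlt⟩ := hS.exists_gt (max m s)
  have hmt : m ≤ t := (le_max_left m s).trans hlt.le
  have hst : s ≤ t := (le_max_right m s).trans hlt.le
  have hlen : (correct A p s).length = (correct A p t).length :=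
    congrArg Fin.val ((hi s hs).trans (hi t ht).symm)
  rw [← mem_correct, (correct_sublist hA hst).eq_of_length hlen]
  exact (correct_sublist hA hmt).subset (mem_correct.mpr hm)

end Instance

/-! ### Reading off the candidates -/

theorem interleave_even (p q : Baire) (n : ℕ) : interleave p q (2 * n) = p n := by
  simp [interleave]

theorem interleave_odd (p q : Baire) (n : ℕ) : interleave p q (2 * n + 1) = q n := by
  have h : (2 * n + 1) / 2 = n := by omega
  simp [interleave, Nat.add_mod, h]

open Classical in
/-- From `⟨p, r⟩`, the candidates of stage `s` for `p`, where `s` is least with `r(s) = 1`. -/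
noncomputable def readCandidates (k : ℕ) : Baire →. Baire := fun z =>
  ⟨∃ s, z (2 * s + 1) = 1, fun h => candidate k (pre (fun t => z (2 * t)) (Nat.find h))⟩

/-- The least `s` with `w(2s+1) = 1`, or half the length of `w` if there is none. -/
def firstHit (w : List ℕ) : ℕ :=
  (List.range (w.length / 2)).findIdx fun s => decide (w.getD (2 * s + 1) 0 = 1)

/-- The word function that computes `readCandidates`. -/
def readCandidatesWord (k : ℕ) (w : List ℕ) : List ℕ :=
  -- Position `2s + 1` lies within `w` exactly when `s < w.length / 2`; equality means no hit so
  -- far.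
  if firstHit w < w.length / 2 then
    (List.range w.length).map
      (candidate k ((List.range (firstHit w)).map fun t => w.getD (2 * t) 0))
  else []

theorem primrec_firstHit : Primrec firstHit := by
  refine Primrec.list_findIdx (Primrec.list_range.comp
    (Primrec.nat_div.comp Primrec.list_length (Primrec.const 2))) ?_
  have h : PrimrecRel fun (w : List ℕ) (s : ℕ) => w.getD (2 * s + 1) 0 = 1 :=
    Primrec.eq.comp ((Primrec.list_getD 0).comp Primrec.fst
      (Primrec.succ.comp (Primrec.nat_mul.comp (Primrec.const 2) Primrec.snd))) (Primrec.const 1)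
  exact h.decide

theorem primrec_readCandidatesWord (k : ℕ) : Primrec (readCandidatesWord k) := by
  have hu : Primrec fun w : List ℕ => (List.range (firstHit w)).map fun t => w.getD (2 * t) 0 :=
    Primrec.list_map (Primrec.list_range.comp primrec_firstHit)
      ((Primrec.list_getD 0).comp Primrec.fst
        (Primrec.nat_mul.comp (Primrec.const 2) Primrec.snd)).to₂
  refine Primrec.ite ?_ ?_ (Primrec.const [])
  · exact Primrec.nat_lt.comp primrec_firstHit
      (Primrec.nat_div.comp Primrec.list_length (Primrec.const 2))
  · exact Primrec.list_map (Primrec.list_range.comp Primrec.list_length)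
      ((primrec_candidate k).comp (hu.comp Primrec.fst) Primrec.snd).to₂

theorem firstHit_pre_eq {z : Baire} {n s : ℕ} (hs : s ≤ n / 2)
    (hmin : ∀ t < s, z (2 * t + 1) ≠ 1) (h : s = n / 2 ∨ z (2 * s + 1) = 1) :
    firstHit (pre z n) = s := by
  rw [firstHit, length_pre]
  refine findIdx_range_eq hs (fun t ht => ?_) ?_
  · rw [getD_pre z (by omega)]
    simpa using hmin t ht
  · rcases hs.eq_or_lt with rfl | hlt
    · exact Or.inl rfl
    · rw [getD_pre z (by omega)]
      exact Or.inr (by simpa using h.resolve_left hlt.ne)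

/-- Once the hit is visible, every output is a prefix of one fixed point, which gives both
monotonicity and correctness. -/
theorem readCandidatesWord_pre_of_hit (k : ℕ) {z : Baire} {s : ℕ}
    (hs : z (2 * s + 1) = 1) (hmin : ∀ t < s, z (2 * t + 1) ≠ 1) (n : ℕ) :
    readCandidatesWord k (pre z n) =
      if s < n / 2 then pre (candidate k (pre (fun t => z (2 * t)) s)) n else [] := by
  by_cases hlt : s < n / 2
  · have hu : (List.range s).map (fun t => (pre z n).getD (2 * t) 0) =
        pre (fun t => z (2 * t)) s :=
      List.map_congr_left fun t ht => getD_pre z (by have := List.mem_range.mp ht; omega)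
    rw [readCandidatesWord, firstHit_pre_eq hlt.le hmin (Or.inr hs), length_pre, hu, if_pos hlt,
      if_pos hlt]
    rfl
  · have hle : n / 2 ≤ s := not_lt.mp hlt
    rw [readCandidatesWord, firstHit_pre_eq le_rfl (fun t ht => hmin t (ht.trans_le hle))
      (Or.inl rfl), length_pre, if_neg (lt_irrefl _), if_neg hlt]

theorem readCandidatesWord_pre_of_no_hit (k : ℕ) {z : Baire}
    (h : ∀ s, z (2 * s + 1) ≠ 1) (n : ℕ) : readCandidatesWord k (pre z n) = [] := by
  rw [readCandidatesWord, firstHit_pre_eq le_rfl (fun t _ => h t) (Or.inl rfl), length_pre,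
    if_neg (lt_irrefl _)]

theorem computableOnBaire_readCandidates (k : ℕ) : ComputableOnBaire (readCandidates k) := by
  classical
  refine ⟨readCandidatesWord k, (primrec_readCandidatesWord k).to_comp,
    prefix_monotone_of_pre fun z m n hmn => ?_, ?_⟩
  · by_cases h : ∃ s, z (2 * s + 1) = 1
    · have hφ := readCandidatesWord_pre_of_hit k (Nat.find_spec h) fun t => Nat.find_min h
      rw [hφ, hφ]
      by_cases hm : Nat.find h < m / 2
      · rw [if_pos hm, if_pos (hm.trans_le (Nat.div_le_div_right hmn))]
        exact pre_prefix _ hmn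
      · rw [if_neg hm]
        exact List.nil_prefix
    · rw [readCandidatesWord_pre_of_no_hit k (not_exists.mp h)]
      exact List.nil_prefix
  · rintro z q ⟨h, rfl⟩
    have hφ := readCandidatesWord_pre_of_hit k (Nat.find_spec h) fun t => Nat.find_min h
    refine ⟨fun n => ?_, fun m => ⟨m + 2 * Nat.find h + 2, ?_⟩⟩
    · rw [hφ]
      split_ifs
      · rw [length_pre]
        simp only [readCandidates]
      · rfl
    · rw [hφ, if_pos (by omega), length_pre]
      omega

theorem mem_readCandidates_interleave (k : ℕ) {p r : Baire} (h : ∃ s, r s = 1) :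
    ∃ s, r s = 1 ∧ candidate k (pre p s) ∈ readCandidates k (interleave p r) := by
  classical
  have h' : ∃ s, interleave p r (2 * s + 1) = 1 := by simpa only [interleave_odd] using h
  refine ⟨Nat.find h', by simpa only [interleave_odd] using Nat.find_spec h', ?_⟩
  have hpre : pre p (Nat.find h') = pre (fun t => interleave p r (2 * t)) (Nat.find h') :=
    pre_congr fun t _ => (interleave_even p r t).symm
  rw [hpre]
  refine ⟨h', ?_⟩
  simp only [readCandidates]

/-! ### The reduction. -/

theorem TCN_pow_reducible_jump_RT1 (k : ℕ) : Reducible (TCN.pow k) (RT1 (k + 1)).jump := by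
  refine ⟨readCandidates k, _, computableOnBaire_readCandidates k,
    computableOnBaire_of_pre (primrec_approxColour k), fun G hG p A hA _ => ?_⟩
  -- A realizer is only constrained on solvable instances; solvability is the pigeonhole principle.
  have hne : ((RT1 (k + 1)).jump.sol (correctColouring A p)).Nonempty := by
    obtain ⟨i, hi⟩ := Finite.exists_infinite_fiber (correctColouring A p)
    exact ⟨correctColouring A p ⁻¹' {i}, Set.infinite_coe_iff.mp hi, i, fun n hn => hn⟩
  obtain ⟨r, hr, S', ⟨hS, i, hi⟩, hrS⟩ := hG _ _ (jump_names_correctColouring hA) hne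
  let S : Set ℕ := S'
  have hmem : ∀ s, r s = 1 → s ∈ S := fun s hs => by
    rcases hrS s with h | h
    · exact h.1
    · exact absurd (hs.symm.trans h.2) one_ne_zero
  have hex : ∃ s, r s = 1 := by
    obtain ⟨s, hs⟩ := hS.nonempty
    rcases hrS s with h | h
    · exact ⟨s, h.2⟩
    · exact absurd hs h.1
  obtain ⟨s, hs, hq⟩ := mem_readCandidates_interleave k (p := p) hex
  refine ⟨candidate k (pre p s), ?_, fun j => candidate k (pre p s) j, fun j hj => ?_,
    fun j => ?_⟩
  · simp only [Part.bind_some, Part.mem_bind_iff]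
    exact ⟨r, hr, hq⟩
  · exact candidate_mem_of_homogeneous hA hS hi (hmem s hs) hj
  -- A number is named by its value at `0`, so only the first `k` output entries matter.
  · change candidate k (pre p s) (k * 0 + j) = _
    rw [mul_zero, zero_add]

end Weihrauch

theorem proposition2 (k : ℕ) :
    Weihrauch.Reducible (Weihrauch.TCN.pow k) (Weihrauch.RT1 (k + 1)).jump := by
  exact Weihrauch.TCN_pow_reducible_jump_RT1 k
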